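/- Let $S$ be a finite set of points (sites) in the Euclidean plane. A triangulation of $S$ is a face-to-face simplicial complex whose vertex set is exactly $S$ and whose union is the convex hull of $S$; it is a Delaunay triangulation if the open disk bounded by the circumcircle of each of its triangles contains no site. Let $DT$ be a Delaunay triangulation of $S$ having at least one triangle, and let $\alpha$ be its sharpest angle, i.e. the smallest of the interior angles of its triangles. A Delaunay circumdisk is the closed disk bounded by the circumcircle of a triangle of $DT$. Then for every point $x$ of the plane, the number of Delaunay circumdisks whose interiors contain $x$ is at most $2\pi/\alpha$. The same bound holds if circumdisks are counted once for each triangle, i.e. at most $2\pi/\alpha$ triangles of $DT$ have a circumdisk whose interior contains $x$. -/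

import Mathlib

namespace PlanarDelaunay

/-- The Euclidean plane. -/
abbrev Plane : Type := EuclideanSpace ℝ (Fin 2)

/-- The triangles (two-dimensional faces) of a simplicial complex in the plane, each given by the
set of its three vertices. -/
def triangles (K : Geometry.SimplicialComplex ℝ Plane) : Set (Finset Plane) :=
  {t | t ∈ K.faces ∧ t.card = 3}

/-- `K` is a triangulation of the finite set of sites `S`: a (face-to-face) simplicial complex
whose vertices are exactly the sites and which fills the convex hull of the sites. -/
structure IsTriangulation (S : Finset Plane) (K : Geometry.SimplicialComplex ℝ Plane) : Prop where
  vertices_eq : K.vertices = (S : Set Plane)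
  space_eq : K.space = convexHull ℝ (S : Set Plane)

/-- `D` is the closed disk bounded by a circle through all points of `t`. For the three vertices of
a nondegenerate triangle in the plane there is exactly one such `D`, the circumdisk. -/
def IsCircumdisk (t : Finset Plane) (D : Set Plane) : Prop :=
  ∃ (c : Plane) (r : ℝ), (∀ v ∈ t, dist v c = r) ∧ D = Metric.closedBall c r

/-- `K` is a Delaunay triangulation of `S`: a triangulation of `S` in which the circumcircle of
each triangle contains no site in its interior. -/
structure IsDelaunayTriangulation (S : Finset Plane) (K : Geometry.SimplicialComplex ℝ Plane) :
    Prop extends IsTriangulation S K where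
  empty_circumdisk : ∀ t ∈ triangles K, ∀ D : Set Plane, IsCircumdisk t D →
    ∀ s ∈ S, s ∉ interior D

open Classical in
/-- The interior angles of the triangles of `K`. The three points are distinct, since a triangle
has three vertices. -/
def triangleAngles (K : Geometry.SimplicialComplex ℝ Plane) : Set ℝ :=
  {θ | ∃ p q r : Plane, ({p, q, r} : Finset Plane) ∈ triangles K ∧
    θ = EuclideanGeometry.angle p q r}

/-- `α` is the sharpest (smallest) angle of the triangles of `K`. In particular `K` has at least
one triangle. -/
def IsSharpestAngle (K : Geometry.SimplicialComplex ℝ Plane) (α : ℝ) : Prop :=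
  IsLeast (triangleAngles K) α

/-- The circumdisks of the triangles of `K`, as a set of closed disks. -/
def circumdisks (K : Geometry.SimplicialComplex ℝ Plane) : Set (Set Plane) :=
  {D | ∃ t ∈ triangles K, IsCircumdisk t D}

end PlanarDelaunay

/-! Assign to each triangle whose open circumdisk contains `x` an apex: a vertex `c` such that `x`
lies in the open cone at `c` spanned by the other two vertices (`exists_isApex`). Near `c` the
segment `cx` runs inside the triangle, so a triangle of the complex is determined by its apex
(`subset_of_isApex`).

Any two apexes `c`, `c'` are seen from `x` at an angle at least `α` (`le_angle_of_isApex`).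
Otherwise, since an angle over a chord at `c` is at least as large from `x` as from the circle, `c'`
lies in the cone from `x` over an edge `cd` of the first triangle. It lies beyond that edge because
the Delaunay disk is empty. By symmetry `c` lies beyond an edge `c'd'` of the second triangle. The
two edges then cross, which is impossible in a face-to-face complex.

Directions pairwise at least `α` apart number at most `2π/α`, by comparing arc lengths
(`card_mul_le_two_pi_of_le_angle`). -/

namespace PlanarDelaunay

/-! ### Determinants and comparison of angles -/

/-- The determinant of two plane vectors. -/
def cross (u v : Plane) : ℝ := u 0 * v 1 - u 1 * v 0

lemma inner_eq_coords (u v : Plane) : inner ℝ u v = u 0 * v 0 + u 1 * v 1 := by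
  simp [PiLp.inner_apply, Fin.sum_univ_two, mul_comm]

lemma norm_sq_eq_coords (u : Plane) : ‖u‖ ^ 2 = u 0 ^ 2 + u 1 ^ 2 := by
  rw [← real_inner_self_eq_norm_sq, inner_eq_coords]; ring

lemma dist_sq_eq_coords (u v : Plane) : dist u v ^ 2 = (u 0 - v 0) ^ 2 + (u 1 - v 1) ^ 2 := by
  rw [dist_eq_norm, norm_sq_eq_coords]; simp

lemma plane_ext {u v : Plane} (h0 : u 0 = v 0) (h1 : u 1 = v 1) : u = v := by
  ext i; fin_cases i <;> assumption

lemma cross_swap (u v : Plane) : cross u v = -cross v u := by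
  simp only [cross]; ring

lemma norm_mul_norm_mul_sin_angle (u v : Plane) :
    ‖u‖ * ‖v‖ * Real.sin (InnerProductGeometry.angle u v) = |cross u v| := by
  have hs := InnerProductGeometry.sin_angle_mul_norm_mul_norm u v
  have e : inner ℝ u u * inner ℝ v v - inner ℝ u v * inner ℝ u v = cross u v ^ 2 := by
    simp only [inner_eq_coords, cross]; ring
  rw [mul_comm, hs, e, Real.sqrt_sq_eq_abs]

lemma norm_mul_norm_mul_sin_angle_sub (u v u' v' : Plane) :
    ‖u‖ * ‖v‖ * (‖u'‖ * ‖v'‖) *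
        Real.sin (InnerProductGeometry.angle u' v' - InnerProductGeometry.angle u v) =
      inner ℝ u v * |cross u' v'| - inner ℝ u' v' * |cross u v| := by
  rw [Real.sin_sub, ← norm_mul_norm_mul_sin_angle, ← norm_mul_norm_mul_sin_angle,
    ← InnerProductGeometry.cos_angle_mul_norm_mul_norm u v,
    ← InnerProductGeometry.cos_angle_mul_norm_mul_norm u' v']
  ring

lemma norm_mul_norm_pos {u v : Plane} (h : cross u v ≠ 0) : 0 < ‖u‖ * ‖v‖ := by
  have hu : u ≠ 0 := by rintro rfl; simp [cross] at h
  have hv : v ≠ 0 := by rintro rfl; simp [cross] at h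
  positivity

/-- Since `|cross u v| = ‖u‖ ‖v‖ sin`, the hypothesis compares cotangents with denominators cleared,
and the cotangent decreases on `(0, π)`. -/
lemma angle_le_angle_of_cot_le {u v u' v' : Plane} (h : cross u v ≠ 0) (h' : cross u' v' ≠ 0)
    (hle : inner ℝ u' v' * |cross u v| ≤ inner ℝ u v * |cross u' v'|) :
    InnerProductGeometry.angle u v ≤ InnerProductGeometry.angle u' v' := by
  by_contra! hlt
  have h0 := norm_mul_norm_mul_sin_angle_sub u v u' v'
  have hpos := mul_pos (norm_mul_norm_pos h) (norm_mul_norm_pos h')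
  have h1 := norm_mul_norm_mul_sin_angle u v
  have hpi : InnerProductGeometry.angle u v ≠ Real.pi := by
    intro e
    rw [e, Real.sin_pi, mul_zero] at h1
    exact h (abs_eq_zero.1 h1.symm)
  have : Real.sin (InnerProductGeometry.angle u' v' - InnerProductGeometry.angle u v) < 0 :=
    Real.sin_neg_of_neg_of_neg_pi_lt (by linarith) (by
      have := lt_of_le_of_ne (InnerProductGeometry.angle_le_pi u v) hpi
      have := InnerProductGeometry.angle_nonneg u' v'
      linarith)
  have := mul_neg_of_pos_of_neg hpos this
  linarith

/-- If `v` and `w` lie on the same side of `u` and `v` makes the smaller angle with `u`, then `v`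
lies between `u` and `w`. -/
lemma cross_mul_cross_pos_of_angle_lt {u v w : Plane} (h : 0 < cross u v * cross u w)
    (hlt : InnerProductGeometry.angle u v < InnerProductGeometry.angle u w) :
    0 < cross u v * cross v w := by
  have hv : cross u v ≠ 0 := left_ne_zero_of_mul h.ne'
  have hw : cross u w ≠ 0 := right_ne_zero_of_mul h.ne'
  have e : (u 0 ^ 2 + u 1 ^ 2) * cross v w = inner ℝ u v * cross u w - inner ℝ u w * cross u v := by
    simp only [inner_eq_coords, cross]; ring
  by_contra! hle
  refine absurd (angle_le_angle_of_cot_le hw hv ?_) (not_le.2 hlt)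
  rcases pos_and_pos_or_neg_and_neg_of_mul_pos h with ⟨h1, h2⟩ | ⟨h1, h2⟩
  · have : (u 0 ^ 2 + u 1 ^ 2) * cross v w ≤ 0 :=
      mul_nonpos_of_nonneg_of_nonpos (by positivity) (nonpos_of_mul_nonpos_right hle h1)
    rw [abs_of_pos h1, abs_of_pos h2]
    linarith
  · have : 0 ≤ (u 0 ^ 2 + u 1 ^ 2) * cross v w := by
      have : 0 ≤ cross v w := by
        by_contra! h3
        linarith [mul_pos_of_neg_of_neg h1 h3]
      positivity
    rw [abs_of_neg h1, abs_of_neg h2]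
    linarith

/-- A point inside a circle sees a chord at an angle at least as large as a point of the circle on
the same side of the chord. -/
lemma inscribed_angle_le {a b c x o : Plane} {r β γ : ℝ} (ha : dist a o = r) (hb : dist b o = r)
    (hc : dist c o = r) (hx : dist x o ≤ r) (hβ : 0 < β)
    (hxe : x - c = β • (a - c) + γ • (b - c)) (h : cross (c - a) (b - a) ≠ 0) :
    EuclideanGeometry.angle c a b ≤ EuclideanGeometry.angle c x b := by
  have h0 : x 0 = c 0 + β * (a 0 - c 0) + γ * (b 0 - c 0) := by
    have := congrArg (fun v : Plane => v 0) hxe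
    simp at this; linarith
  have h1 : x 1 = c 1 + β * (a 1 - c 1) + γ * (b 1 - c 1) := by
    have := congrArg (fun v : Plane => v 1) hxe
    simp at this; linarith
  have hcr : cross (c - x) (b - x) = β * cross (c - a) (b - a) := by
    simp only [cross, PiLp.sub_apply, h0, h1]; ring
  have h' : cross (c - x) (b - x) ≠ 0 := hcr ▸ mul_ne_zero hβ.ne' h
  refine angle_le_angle_of_cot_le h h' ?_
  simp only [vsub_eq_sub]
  have ha' := dist_sq_eq_coords a o
  have hb' := dist_sq_eq_coords b o
  have hc' := dist_sq_eq_coords c o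
  have hx' := dist_sq_eq_coords x o
  rw [ha] at ha'; rw [hb] at hb'; rw [hc] at hc'
  -- The determinant at `x` is `β` times the one at `a`, so the cotangents differ by a positive
  -- multiple of the power of `x`, which is nonpositive inside the circle.
  have key : inner ℝ (c - x) (b - x) - β * inner ℝ (c - a) (b - a) = dist x o ^ 2 - r ^ 2 := by
    rw [hx']
    simp only [inner_eq_coords, PiLp.sub_apply, h0, h1]
    linear_combination β * ha' + (1 - β - γ) * hc' + γ * hb'
  have hle : dist x o ^ 2 ≤ r ^ 2 := by gcongr
  rw [hcr, abs_mul, abs_of_pos hβ]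
  have := abs_pos.2 h
  nlinarith

/-! ### Packing directions on the circle -/

/-- Nonzero plane vectors with pairwise angles at least `α` number at most `2π/α`. -/
lemma card_mul_le_two_pi_of_le_angle {ι : Type*} (s : Finset ι) (f : ι → Plane) {α : ℝ}
    (hα : 0 < α) (hαπ : α ≤ Real.pi) (hf : ∀ i ∈ s, f i ≠ 0)
    (h : ∀ i ∈ s, ∀ j ∈ s, i ≠ j → α ≤ InnerProductGeometry.angle (f i) (f j)) :
    s.card * α ≤ 2 * Real.pi := by
  have : Fact (0 < 2 * Real.pi) := ⟨Real.two_pi_pos⟩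
  let e := Complex.orthonormalBasisOneI.repr.symm
  let g : ι → AddCircle (2 * Real.pi) := fun i => ((e (f i)).arg : AddCircle (2 * Real.pi))
  have hdist : ∀ i ∈ s, ∀ j ∈ s, dist (g i) (g j) = InnerProductGeometry.angle (f i) (f j) := by
    intro i hi j hj
    have hi0 : e (f i) ≠ 0 := by simpa using hf i hi
    have hj0 : e (f j) ≠ 0 := by simpa using hf j hj
    have h1 : g i - g j = ((e (f i) / e (f j)).arg : AddCircle (2 * Real.pi)) :=
      (Complex.arg_div_coe_angle hi0 hj0).symm
    rw [dist_eq_norm, h1, ← e.toLinearIsometry.angle_map]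
    change _ = InnerProductGeometry.angle (e (f i)) (e (f j))
    rw [Complex.angle_eq_abs_arg hi0 hj0]
    refine (AddCircle.norm_coe_eq_abs_iff _ Real.two_pi_pos.ne').2 ?_
    rw [abs_of_pos Real.two_pi_pos]
    linarith [Complex.abs_arg_le_pi (e (f i) / e (f j))]
  -- Closed arcs of length exactly `α` could touch. Shrinking to length `ε < α` makes them disjoint,
  -- and letting `y` approach `s.card * α` loses nothing.
  refine le_of_forall_lt_imp_le_of_dense fun y hy => ?_
  rcases s.eq_empty_or_nonempty with rfl | hs
  · simp at hy; linarith [Real.pi_pos]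
  have hcard : (0 : ℝ) < s.card := by exact_mod_cast hs.card_pos
  by_cases hy0 : y ≤ 0
  · linarith [Real.pi_pos]
  push Not at hy0
  set ε := y / s.card with hε
  have hε0 : 0 < ε := by positivity
  have hεα : ε < α := by rw [hε, div_lt_iff₀ hcard]; linarith
  have hdisj : Set.PairwiseDisjoint (s : Set ι) fun i => Metric.closedBall (g i) (ε / 2) := by
    intro i hi j hj hij
    refine Metric.closedBall_disjoint_closedBall ?_
    rw [hdist i hi j hj]
    linarith [h i hi j hj hij]
  have hvol := MeasureTheory.measure_biUnion_finset (μ := MeasureTheory.volume) hdisj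
    fun i _ => Metric.isClosed_closedBall.measurableSet
  have hle : MeasureTheory.volume (⋃ i ∈ s, Metric.closedBall (g i) (ε / 2)) ≤
      ENNReal.ofReal (2 * Real.pi) := by
    rw [← AddCircle.measure_univ]
    exact MeasureTheory.measure_mono (Set.subset_univ _)
  rw [hvol] at hle
  simp only [AddCircle.volume_closedBall] at hle
  rw [min_eq_right (by linarith), Finset.sum_const, nsmul_eq_mul, ← ENNReal.ofReal_natCast,
    ← ENNReal.ofReal_mul (by positivity), ENNReal.ofReal_le_ofReal_iff Real.two_pi_pos.le] at hle
  have : (s.card : ℝ) * (2 * (ε / 2)) = y := by rw [hε]; field_simp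
  linarith

/-! ### Triangles and their apexes -/

/-- Coordinates of a point with respect to a nondegenerate triangle. -/
lemma exists_coords {a b c : Plane} (h : cross (a - c) (b - c) ≠ 0) (x : Plane) :
    ∃ β γ : ℝ, x - c = β • (a - c) + γ • (b - c) := by
  refine ⟨cross (x - c) (b - c) / cross (a - c) (b - c),
    cross (a - c) (x - c) / cross (a - c) (b - c), ?_⟩
  apply plane_ext <;> simp only [PiLp.add_apply, PiLp.smul_apply, smul_eq_mul] <;>
    field_simp <;> simp only [cross, PiLp.sub_apply] <;> ring

lemma cross_ne_zero_of_affineIndependent {a b c : Plane}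
    (h : AffineIndependent ℝ ![a, b, c]) : cross (a - c) (b - c) ≠ 0 := by
  intro h0
  have hbc : b - c ≠ 0 := by
    intro e
    have := h.injective.ne (show (1 : Fin 3) ≠ 2 by decide)
    simp [sub_eq_zero.1 e] at this
  rw [affineIndependent_iff_not_collinear_set] at h
  apply h
  rw [collinear_iff_of_mem (p₀ := c) (by simp)]
  refine ⟨b - c, ?_⟩
  have hn : (b - c) 0 ^ 2 + (b - c) 1 ^ 2 ≠ 0 := by
    rw [← norm_sq_eq_coords]; simpa using hbc
  simp only [Set.mem_insert_iff, Set.mem_singleton_iff, forall_eq_or_imp, forall_eq, vadd_eq_add]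
  refine ⟨⟨inner ℝ (a - c) (b - c) / ((b - c) 0 ^ 2 + (b - c) 1 ^ 2), ?_⟩, ⟨1, by simp⟩,
    ⟨0, by simp⟩⟩
  rw [← sub_eq_iff_eq_add]
  rw [inner_eq_coords]
  simp only [cross] at h0
  apply plane_ext <;> simp only [PiLp.smul_apply, smul_eq_mul] <;>
    rw [div_mul_eq_mul_div, eq_div_iff hn]
  · linear_combination ((b - c) 1) * h0
  · linear_combination (-(b - c) 0) * h0

lemma cross_ne_zero_of_mem_triangles {K : Geometry.SimplicialComplex ℝ Plane} {t : Finset Plane}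
    (ht : t ∈ triangles K) {a b c : Plane} (hab : a ≠ b) (hac : a ≠ c) (hbc : b ≠ c)
    (ha : a ∈ t) (hb : b ∈ t) (hc : c ∈ t) : cross (a - c) (b - c) ≠ 0 := by
  apply cross_ne_zero_of_affineIndependent
  have hinj : Function.Injective (![⟨a, ha⟩, ⟨b, hb⟩, ⟨c, hc⟩] : Fin 3 → t) := by
    intro i j hij
    fin_cases i <;> fin_cases j <;> simp_all
  have e : ![a, b, c] = (Subtype.val : t → Plane) ∘ ![⟨a, ha⟩, ⟨b, hb⟩, ⟨c, hc⟩] := by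
    funext i
    fin_cases i <;> rfl
  rw [e]
  exact (K.indep ht.1).comp_embedding ⟨_, hinj⟩

/-- The vertex `c` of the triangle `abc` is the one through which the ray from `x` leaves it: the
triangle contains points of the open segment from `c` to `x` near `c` in its interior. -/
def IsApex (x a b c : Plane) : Prop :=
  ∃ β γ : ℝ, 0 < β ∧ 0 < γ ∧ x - c = β • (a - c) + γ • (b - c)

lemma IsApex.symm {x a b c : Plane} (h : IsApex x a b c) : IsApex x b a c := by
  obtain ⟨β, γ, hβ, hγ, e⟩ := h
  exact ⟨γ, β, hγ, hβ, by rw [e, add_comm]⟩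

/-- If both coordinates were nonpositive, solving for `c - o` and taking norms would give `(1 - β -
γ) r ≤ dist x o + (-β - γ) r`, hence `r ≤ dist x o`. -/
lemma pos_coord_of_dist_lt {a b c x o : Plane} {r β γ : ℝ} (ha : dist a o = r)
    (hb : dist b o = r) (hc : dist c o = r) (hx : dist x o < r)
    (e : x - c = β • (a - c) + γ • (b - c)) (hβ : β ≤ 0) : 0 < γ := by
  by_contra! hγ
  have e' : (1 - β - γ) • (c - o) = (x - o) + (-β) • (a - o) + (-γ) • (b - o) := by
    linear_combination (norm := module) (-1 : ℝ) • e
  have h1 : ‖(1 - β - γ) • (c - o)‖ ≤ ‖x - o‖ + ‖(-β) • (a - o)‖ + ‖(-γ) • (b - o)‖ := by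
    rw [e']; exact norm_add₃_le
  rw [norm_smul, norm_smul, norm_smul, Real.norm_of_nonneg (by linarith),
    Real.norm_of_nonneg (by linarith), Real.norm_of_nonneg (by linarith), ← dist_eq_norm,
    ← dist_eq_norm, ← dist_eq_norm, ← dist_eq_norm, ha, hb, hc] at h1
  nlinarith

open Classical in
lemma ne_of_card_eq_three {a b c : Plane} (h : ({a, b, c} : Finset Plane).card = 3) :
    a ≠ b ∧ a ≠ c ∧ b ≠ c := by
  refine ⟨?_, ?_, ?_⟩ <;> rintro rfl
  · have := Finset.card_le_two (a := a) (b := c); simp_all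
  · have := Finset.card_le_two (a := a) (b := b); simp_all [Finset.pair_comm]
  · have := Finset.card_le_two (a := a) (b := b); simp_all

-- At most one of the barycentric coordinates `β`, `γ`, `1 - β - γ` of `x` is nonpositive. The apex
-- is a vertex whose two companions have positive coordinates.
open Classical in
lemma exists_isApex {K : Geometry.SimplicialComplex ℝ Plane} {t : Finset Plane}
    (ht : t ∈ triangles K) {x o : Plane} {r : ℝ} (hr : ∀ v ∈ t, dist v o = r)
    (hx : dist x o < r) : ∃ a b c : Plane, t = {a, b, c} ∧ IsApex x a b c := by
  obtain ⟨a, b, c, hab, hac, hbc, rfl⟩ := Finset.card_eq_three.1 ht.2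
  obtain ⟨β, γ, e⟩ := exists_coords
    (cross_ne_zero_of_mem_triangles ht hab hac hbc (by simp) (by simp) (by simp)) x
  have ha : dist a o = r := hr _ (by simp)
  have hb : dist b o = r := hr _ (by simp)
  have hc : dist c o = r := hr _ (by simp)
  have ea : x - a = γ • (b - a) + (1 - β - γ) • (c - a) := by
    linear_combination (norm := module) (1 : ℝ) • e
  have eb : x - b = β • (a - b) + (1 - β - γ) • (c - b) := by
    linear_combination (norm := module) (1 : ℝ) • e
  by_cases hβ : 0 < β
  · by_cases hγ : 0 < γ
    · exact ⟨a, b, c, rfl, β, γ, hβ, hγ, e⟩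
    · refine ⟨a, c, b, ?_, β, _, hβ, pos_coord_of_dist_lt hb hc ha hx ea (not_lt.1 hγ), eb⟩
      ext; simp; tauto
  · refine ⟨b, c, a, ?_, γ, _, pos_coord_of_dist_lt ha hb hc hx e (not_lt.1 hβ),
      pos_coord_of_dist_lt ha hc hb hx eb (not_lt.1 hβ), ea⟩
    ext; simp; tauto

/-- Without `a`, the hull stays on the line `bc`, while `β ≠ 0` puts `z` off it. -/
lemma mem_of_mem_convexHull_triangle {a b c z : Plane} {β γ : ℝ} {s : Set Plane}
    (hne : cross (a - c) (b - c) ≠ 0) (hs : s ⊆ {a, b, c})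
    (hz : z - c = β • (a - c) + γ • (b - c)) (hβ : β ≠ 0) (hzs : z ∈ convexHull ℝ s) : a ∈ s := by
  by_contra has
  have hsub : convexHull ℝ s ⊆ {y | cross (y - c) (b - c) = 0} := by
    refine convexHull_min ?_ ?_
    · intro y hy
      rcases hs hy with rfl | rfl | rfl
      · exact absurd hy has
      · simp [cross, mul_comm]
      · simp [cross]
    · intro y hy w hw p q _ _ hpq
      simp only [Set.mem_ofPred_eq, cross, PiLp.sub_apply, PiLp.add_apply, PiLp.smul_apply,
        smul_eq_mul] at hy hw ⊢
      obtain rfl : q = 1 - p := by linarith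
      linear_combination p * hy + (1 - p) * hw
  have h1 : cross (z - c) (b - c) = 0 := hsub hzs
  have h2 : cross (z - c) (b - c) = β * cross (a - c) (b - c) := by
    rw [hz]; simp only [cross, PiLp.sub_apply, PiLp.add_apply, PiLp.smul_apply, smul_eq_mul]; ring
  exact mul_ne_zero hβ hne (h2 ▸ h1)

lemma mem_convexHull_triangle {a b c z : Plane} {β γ : ℝ} (hβ : 0 ≤ β) (hγ : 0 ≤ γ)
    (h1 : β + γ ≤ 1) (hz : z - c = β • (a - c) + γ • (b - c)) :
    z ∈ convexHull ℝ ({a, b, c} : Set Plane) := by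
  have hc := convex_convexHull ℝ ({a, b, c} : Set Plane)
  have hsub := subset_convexHull ℝ ({a, b, c} : Set Plane)
  have := hc.sum_mem (t := (Finset.univ : Finset (Fin 3))) (w := ![β, γ, 1 - β - γ])
    (z := ![a, b, c]) (by
      intro i _; fin_cases i <;> simp <;> linarith) (by simp [Fin.sum_univ_three]) (by
      intro i _; fin_cases i <;> exact hsub (by simp))
  convert this using 1
  simp only [Fin.sum_univ_three, Matrix.cons_val]
  linear_combination (norm := module) (1 : ℝ) • hz

open Classical in
/-- A triangle of a planar complex is determined by its apex with respect to a given point. -/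
lemma subset_of_isApex {K : Geometry.SimplicialComplex ℝ Plane} {x a b c a' b' : Plane}
    (ht : ({a, b, c} : Finset Plane) ∈ triangles K)
    (ht' : ({a', b', c} : Finset Plane) ∈ triangles K)
    (h : IsApex x a b c) (h' : IsApex x a' b' c) :
    ({a, b, c} : Finset Plane) ⊆ {a', b', c} := by
  have hne : cross (a - c) (b - c) ≠ 0 := by
    obtain ⟨hab, hac, hbc⟩ := ne_of_card_eq_three ht.2
    exact cross_ne_zero_of_mem_triangles ht hab hac hbc (by simp) (by simp) (by simp)
  obtain ⟨β, γ, hβ, hγ, e⟩ := h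
  obtain ⟨β', γ', hβ', hγ', e'⟩ := h'
  -- Small enough that `c + ε • (x - c)` has coordinate sum at most 1 in both triangles, so it
  -- belongs to both.
  set ε := (1 + β + γ + β' + γ')⁻¹ with hε
  have hε0 : 0 < ε := by positivity
  have hε1 : ε * (1 + β + γ + β' + γ') = 1 := inv_mul_cancel₀ (by positivity)
  have hz : (c + ε • (x - c)) - c = (ε * β) • (a - c) + (ε * γ) • (b - c) := by
    rw [e]; module
  have hz' : (c + ε • (x - c)) - c = (ε * β') • (a' - c) + (ε * γ') • (b' - c) := by
    rw [e']; module
  have hβε := mul_pos hε0 hβ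
  have hγε := mul_pos hε0 hγ
  have hβε' := mul_pos hε0 hβ'
  have hγε' := mul_pos hε0 hγ'
  have hmem := mem_convexHull_triangle hβε.le hγε.le (by nlinarith) hz
  have hmem' := mem_convexHull_triangle hβε'.le hγε'.le (by nlinarith) hz'
  have hint := K.inter_subset_convexHull ht.1 ht'.1 ⟨by simpa using hmem, by simpa using hmem'⟩
  have hsub : ((({a, b, c} : Finset Plane) : Set Plane) ∩ (({a', b', c} : Finset Plane) : Set Plane))
    ⊆ {a, b, c} := fun y hy => by simpa using hy.1
  have ha := (mem_of_mem_convexHull_triangle hne hsub hz hβε.ne' hint).2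
  have hb := (mem_of_mem_convexHull_triangle (a := b) (b := a) (β := ε * γ) (γ := ε * β)
    (by rw [cross_swap]; simpa using hne) (by rwa [Set.insert_comm]) (by rw [hz, add_comm])
    hγε.ne' hint).2
  intro y hy
  simp only [Finset.mem_insert, Finset.mem_singleton] at hy
  rcases hy with rfl | rfl | rfl
  · exact_mod_cast ha
  · exact_mod_cast hb
  · simp

/-! ### Points seen beyond an edge -/

/-- A point outside an open disk, in the cone of two chord endpoints seen from a point of the disk,
lies beyond the chord. -/
lemma one_lt_add_of_dist_lt {x c b y o : Plane} {r s w : ℝ} (hx : dist x o < r)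
    (hc : dist c o = r) (hb : dist b o = r) (hcb : c ≠ b) (hy : r ≤ dist y o) (hs : 0 < s)
    (hw : 0 < w) (e : y - x = s • (c - x) + w • (b - x)) : 1 < s + w := by
  by_contra! hle
  refine absurd hy (not_le.2 ?_)
  have hr : r ≠ 0 := by
    have := dist_nonneg (x := x) (y := o)
    intro h; linarith
  have hsw : 0 < s + w := by positivity
  -- By strict convexity the ray from `x` to `y` meets the chord inside the open disk; if `s + w ≤
  -- 1`, then `y` would come no later than that point.
  have hm : (s / (s + w)) • c + (w / (s + w)) • b ∈ Metric.ball o r := by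
    rw [← interior_closedBall o hr]
    refine (strictConvex_closedBall ℝ o r).openSegment_subset (x := c) (y := b)
      (by simp [hc]) (by simp [hb]) hcb ⟨_, _, by positivity, by positivity, by field_simp, rfl⟩
  have := convex_ball (E := Plane) o r (Metric.mem_ball.2 hx) hm (sub_nonneg.2 hle) hsw.le
    (sub_add_cancel 1 (s + w))
  rw [smul_add, smul_smul, smul_smul, mul_div_cancel₀ _ hsw.ne', mul_div_cancel₀ _ hsw.ne'] at this
  obtain rfl : y = (1 - (s + w)) • x + (s • c + w • b) := by
    linear_combination (norm := module) (1 : ℝ) • e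
  exact this

lemma one_le_of_dist_lt {x c y o : Plane} {r k : ℝ} (hx : dist x o < r)
    (hc : dist c o = r) (hy : r ≤ dist y o) (hk : 0 ≤ k)
    (e : y - x = k • (c - x)) : 1 ≤ k := by
  by_contra! hlt
  refine absurd hy (not_le.2 ?_)
  have e' : y - o = (1 - k) • (x - o) + k • (c - o) := by linear_combination (norm := module) (1 : ℝ) • e
  rw [dist_eq_norm, e']
  refine (norm_add_le _ _).trans_lt ?_
  rw [norm_smul, norm_smul, Real.norm_of_nonneg hk, Real.norm_of_nonneg (by linarith),
    ← dist_eq_norm, ← dist_eq_norm, hc]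
  nlinarith

lemma exists_smul_eq_of_cross_eq_zero {u v : Plane} (hu : u ≠ 0) (h : cross u v = 0) :
    ∃ k : ℝ, v = k • u := by
  have hn : u 0 ^ 2 + u 1 ^ 2 ≠ 0 := by rw [← norm_sq_eq_coords]; simpa using hu
  refine ⟨inner ℝ u v / (u 0 ^ 2 + u 1 ^ 2), ?_⟩
  simp only [cross] at h
  rw [inner_eq_coords]
  apply plane_ext <;> simp only [PiLp.smul_apply, smul_eq_mul] <;>
    rw [div_mul_eq_mul_div, eq_div_iff hn]
  · linear_combination (-u 1) * h
  · linear_combination (u 0) * h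

lemma IsApex.cross_eq {x a b c : Plane} {β γ : ℝ} (e : x - c = β • (a - c) + γ • (b - c)) :
    cross (c - x) (a - x) = γ * cross (a - c) (b - c) ∧
      cross (c - x) (b - x) = -β * cross (a - c) (b - c) := by
  obtain rfl : x = c + (β • (a - c) + γ • (b - c)) := by rw [← e]; abel
  constructor <;> simp only [cross, PiLp.sub_apply, PiLp.add_apply, PiLp.smul_apply, smul_eq_mul] <;>
    ring

/-- The inscribed angle bound gives `∠ c x y < α ≤ ∠ c a b ≤ ∠ c x b`. As `y` and `b` are on the
same side of the line `xc`, `y` lies in the cone over `cb`; Cramer's rule gives its coefficients. -/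
lemma exists_cone_of_angle_lt_aux {a b c x y o : Plane} {r α : ℝ} (ha : dist a o = r)
    (hb : dist b o = r) (hc : dist c o = r) (hx : dist x o < r) (hy : r ≤ dist y o)
    (hne : cross (a - c) (b - c) ≠ 0) (h : IsApex x a b c)
    (hα : α ≤ EuclideanGeometry.angle c a b) (hlt : EuclideanGeometry.angle c x y < α)
    (hpos : 0 < cross (c - x) (y - x) * cross (c - x) (b - x)) :
    ∃ s w : ℝ, 0 < s ∧ 0 < w ∧ 1 < s + w ∧ y - x = s • (c - x) + w • (b - x) := by
  obtain ⟨β, γ, hβ, hγ, e⟩ := h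
  have hne' : cross (c - a) (b - a) ≠ 0 := by
    rw [← neg_ne_zero]
    convert hne using 1; simp only [cross, PiLp.sub_apply]; ring
  have hang := hlt.trans_le (hα.trans (inscribed_angle_le ha hb hc hx.le hβ e hne'))
  have hpos' := cross_mul_cross_pos_of_angle_lt hpos hang
  have h0 : cross (c - x) (b - x) ≠ 0 := right_ne_zero_of_mul hpos.ne'
  have h1 : cross (c - x) (y - x) ≠ 0 := left_ne_zero_of_mul hpos.ne'
  have hs : 0 < cross (y - x) (b - x) / cross (c - x) (b - x) := by
    have : 0 < (cross (c - x) (y - x) * cross (y - x) (b - x)) /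
      (cross (c - x) (y - x) * cross (c - x) (b - x)) := div_pos hpos' hpos
    rwa [mul_div_mul_left _ _ h1] at this
  have hw : 0 < cross (c - x) (y - x) / cross (c - x) (b - x) := by
    rcases pos_and_pos_or_neg_and_neg_of_mul_pos hpos with ⟨h2, h3⟩ | ⟨h2, h3⟩
    exacts [div_pos h2 h3, div_pos_of_neg_of_neg h2 h3]
  have he : y - x = (cross (y - x) (b - x) / cross (c - x) (b - x)) • (c - x) +
      (cross (c - x) (y - x) / cross (c - x) (b - x)) • (b - x) := by
    apply plane_ext <;> simp only [PiLp.add_apply, PiLp.smul_apply, smul_eq_mul] <;>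
      field_simp <;> simp only [cross, PiLp.sub_apply] <;> ring
  refine ⟨_, _, hs, hw, one_lt_add_of_dist_lt hx hc hb ?_ hy hs hw he, he⟩
  rintro rfl
  simp [cross] at hne

/-- A point outside the circumdisk which is seen from `x` close to the apex `c` is seen through one
of the two edges at `c`. -/
lemma exists_cone_of_angle_lt {a b c x y o : Plane} {r α : ℝ} (ha : dist a o = r)
    (hb : dist b o = r) (hc : dist c o = r) (hx : dist x o < r) (hy : r ≤ dist y o)
    (hne : cross (a - c) (b - c) ≠ 0) (h : IsApex x a b c)
    (hα : α ≤ EuclideanGeometry.angle c a b) (hα' : α ≤ EuclideanGeometry.angle c b a)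
    (hlt : EuclideanGeometry.angle c x y < α) (hcr : cross (c - x) (y - x) ≠ 0) :
    ∃ d, (d = a ∨ d = b) ∧
      ∃ s w : ℝ, 0 < s ∧ 0 < w ∧ 1 < s + w ∧ y - x = s • (c - x) + w • (d - x) := by
  by_cases hpos : 0 < cross (c - x) (y - x) * cross (c - x) (b - x)
  · exact ⟨b, Or.inr rfl, exists_cone_of_angle_lt_aux ha hb hc hx hy hne h hα hlt hpos⟩
  · refine ⟨a, Or.inl rfl, exists_cone_of_angle_lt_aux hb ha hc hx hy
      (by rw [cross_swap]; simpa using hne) h.symm hα' hlt ?_⟩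
    obtain ⟨β, γ, hβ, hγ, e⟩ := h
    -- The coefficients `γ` and `-β` put `a` and `b` on opposite sides of the line `xc`, so if `y`
    -- is not on the side of `b` it is on that of `a`.
    obtain ⟨h1, h2⟩ := IsApex.cross_eq e
    rw [h2] at hpos
    rw [h1]
    have h3 : 0 < -(cross (c - x) (y - x) * cross (a - c) (b - c)) → False := fun h => hpos (by
      have := mul_pos hβ h
      linarith)
    have h4 : cross (c - x) (y - x) * cross (a - c) (b - c) ≠ 0 := mul_ne_zero hcr hne
    have h5 : 0 < cross (c - x) (y - x) * cross (a - c) (b - c) :=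
      lt_of_le_of_ne (by by_contra! h; exact h3 (by linarith)) h4.symm
    have := mul_pos hγ h5
    linarith

/-! ### Crossing edges and the angle between apexes -/

lemma exists_mem_openSegment_inter {x b c b' c' : Plane} {s w s' w' : ℝ} (hs : 0 < s) (hw : 0 < w)
    (hsw : 1 < s + w) (hs' : 0 < s') (hw' : 0 < w') (hsw' : 1 < s' + w')
    (e : c' - x = s • (c - x) + w • (b - x)) (e' : c - x = s' • (c' - x) + w' • (b' - x)) :
    ∃ z, z ∈ openSegment ℝ c b ∧ z ∈ openSegment ℝ c' b' := by
  have hd : 0 < (s + w) * (s' + w') - 1 := by nlinarith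
  -- The crossing point is `x + X • (c' - x) + Y • (c - x)`. Expanding `c' - x` by `e`, or `c - x`
  -- by `e'`, it lies on each edge's line exactly when `h1` and `h2` hold; `X`, `Y` solve this
  -- system.
  set X := (s' + w' - 1) / ((s + w) * (s' + w') - 1) with hX
  set Y := (s + w - 1) / ((s + w) * (s' + w') - 1) with hY
  have hX0 : 0 < X := div_pos (by linarith) hd
  have hY0 : 0 < Y := div_pos (by linarith) hd
  have h1 : X * (s + w) + Y = 1 := by
    rw [hX, hY, div_mul_eq_mul_div, ← add_div, div_eq_one_iff_eq hd.ne']; ring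
  have h2 : X + Y * (s' + w') = 1 := by
    rw [hX, hY, div_mul_eq_mul_div, ← add_div, div_eq_one_iff_eq hd.ne']; ring
  refine ⟨(Y + s * X) • c + (w * X) • b,
    ⟨_, _, by positivity, by positivity, by linarith, rfl⟩,
    ⟨X + s' * Y, w' * Y, by positivity, by positivity, by linarith, ?_⟩⟩
  have hY' : Y = 1 - X * (s + w) := by linarith
  have h3 : (X * (s + w) + Y) • x = (X + Y * (s' + w')) • x := by rw [h1, h2]
  linear_combination (norm := module) (X : ℝ) • e - (Y : ℝ) • e' + h3

lemma mem_of_mem_openSegment {b c z : Plane} {s : Set Plane} (hcb : c ≠ b) (hs : s ⊆ {c, b})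
    (hz : z ∈ openSegment ℝ c b) (hzs : z ∈ convexHull ℝ s) : c ∈ s := by
  by_contra hcs
  have hsub : s ⊆ {b} := fun y hy => (hs hy).resolve_left fun h => hcs (h ▸ hy)
  have h1 := convexHull_mono hsub hzs
  rw [convexHull_singleton, Set.mem_singleton_iff] at h1
  subst h1
  exact hcb (right_mem_openSegment_iff.1 hz)

open Classical in
/-- Two edges of a simplicial complex which cross have the same endpoints. -/
lemma edge_eq_of_mem_openSegment {K : Geometry.SimplicialComplex ℝ Plane} {t t' : Finset Plane}
    (ht : t ∈ K.faces) (ht' : t' ∈ K.faces) {b c b' c' z : Plane} (hb : b ∈ t) (hc : c ∈ t)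
    (hb' : b' ∈ t') (hc' : c' ∈ t') (hcb : c ≠ b) (hz : z ∈ openSegment ℝ c b)
    (hz' : z ∈ openSegment ℝ c' b') : c = c' ∨ c = b' := by
  have hf : ({c, b} : Finset Plane) ∈ K.faces :=
    K.down_closed ht (by simp [Finset.insert_subset_iff, hb, hc]) (by simp)
  have hf' : ({c', b'} : Finset Plane) ∈ K.faces :=
    K.down_closed ht' (by simp [Finset.insert_subset_iff, hb', hc']) (by simp)
  have hint := K.inter_subset_convexHull hf hf'
    ⟨by simpa using openSegment_subset_segment ℝ _ _ hz,
      by simpa using openSegment_subset_segment ℝ _ _ hz'⟩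
  have := mem_of_mem_openSegment hcb (fun y hy => by simpa using hy.1) hz hint
  simpa using this.2

open Classical in
/-- The apexes of two Delaunay triangles, whose circumdisks contain `x`, are seen from `x` at an
angle at least the sharpest angle of the complex. -/
lemma le_angle_of_isApex {K : Geometry.SimplicialComplex ℝ Plane} {α : ℝ}
    (hα : α ∈ lowerBounds (triangleAngles K)) (hαπ : α ≤ Real.pi) {x a b c a' b' c' o o' : Plane}
    {r r' : ℝ} (ht : ({a, b, c} : Finset Plane) ∈ triangles K)
    (ht' : ({a', b', c'} : Finset Plane) ∈ triangles K)
    (hr : ∀ v ∈ ({a, b, c} : Finset Plane), dist v o = r)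
    (hr' : ∀ v ∈ ({a', b', c'} : Finset Plane), dist v o' = r')
    (hx : dist x o < r) (hx' : dist x o' < r') (hy : r ≤ dist c' o) (hy' : r' ≤ dist c o')
    (h : IsApex x a b c) (h' : IsApex x a' b' c') (hcc : c ≠ c') :
    α ≤ EuclideanGeometry.angle c x c' := by
  have hang : ∀ {p q r : Plane}, ({p, q, r} : Finset Plane) ∈ triangles K →
      α ≤ EuclideanGeometry.angle p q r := fun hm => hα ⟨_, _, _, hm, rfl⟩
  have hca : dist c o = r := hr c (by simp)
  have hca' : dist c' o' = r' := hr' c' (by simp)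
  have hne {a b c : Plane} (ht : ({a, b, c} : Finset Plane) ∈ triangles K) :
      cross (a - c) (b - c) ≠ 0 := by
    obtain ⟨hab, hac, hbc⟩ := ne_of_card_eq_three ht.2
    exact cross_ne_zero_of_mem_triangles ht hab hac hbc (by simp) (by simp) (by simp)
  have hrot {a b c : Plane} : ({c, a, b} : Finset Plane) = {a, b, c} := by ext; simp; tauto
  have hrot' {a b c : Plane} : ({c, b, a} : Finset Plane) = {a, b, c} := by ext; simp; tauto
  by_contra! hlt
  by_cases hcr : cross (c - x) (c' - x) = 0
  · have hcx : c - x ≠ 0 := by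
      intro e0
      rw [sub_eq_zero.1 e0] at hca
      exact hx.ne hca
    obtain ⟨k, hk⟩ := exists_smul_eq_of_cross_eq_zero hcx hcr
    -- On opposite rays the angle is `π ≥ α`. On a common ray each apex lies outside the other's
    -- open disk, so neither is nearer to `x` and they coincide.
    rcases lt_or_ge k 0 with hk0 | hk0
    · have : EuclideanGeometry.angle c x c' = Real.pi := by
        simp only [EuclideanGeometry.angle, vsub_eq_sub, hk]
        rw [InnerProductGeometry.angle_smul_right_of_neg _ _ hk0,
          InnerProductGeometry.angle_self_neg_of_nonzero hcx]
      linarith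
    · have h1 := one_le_of_dist_lt hx hca hy hk0 hk
      have hk' : c - x = k⁻¹ • (c' - x) := by
        rw [hk, smul_smul, inv_mul_cancel₀ (by linarith), one_smul]
      have h2 := one_le_of_dist_lt hx' hca' hy' (inv_nonneg.2 hk0) hk'
      have h3 : k = 1 := le_antisymm (by
        have := (one_le_inv₀ (by linarith)).1 h2
        exact this) h1
      rw [h3, one_smul] at hk
      exact hcc (sub_left_injective hk).symm
  · obtain ⟨d, hd, s, w, hs, hw, hsw, e⟩ := exists_cone_of_angle_lt (hr a (by simp))
      (hr b (by simp)) hca hx hy (hne ht) h (hang (by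
        rwa [Finset.insert_comm, Finset.pair_comm c b])) (hang (by rwa [hrot'])) hlt hcr
    obtain ⟨d', hd', s', w', hs', hw', hsw', e'⟩ := exists_cone_of_angle_lt (hr' a' (by simp))
      (hr' b' (by simp)) hca' hx' hy' (hne ht') h' (hang (by
        rwa [Finset.insert_comm, Finset.pair_comm c' b'])) (hang (by rwa [hrot']))
      (by rwa [EuclideanGeometry.angle_comm]) (by rw [cross_swap]; simpa using hcr)
    obtain ⟨z, hz, hz'⟩ := exists_mem_openSegment_inter hs hw hsw hs' hw' hsw' e e'
    have hcd : c ≠ d := by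
      obtain ⟨-, hac, hbc⟩ := ne_of_card_eq_three ht.2
      rcases hd with rfl | rfl
      exacts [hac.symm, hbc.symm]
    rcases edge_eq_of_mem_openSegment ht.1 ht'.1 (by rcases hd with rfl | rfl <;> simp) (by simp)
      (by rcases hd' with rfl | rfl <;> simp) (by simp) hcd hz hz' with h1 | rfl
    · exact hcc h1
    -- Here `c` is the other endpoint of the second edge, so `e'` makes `c - x` and `c' - x`
    -- parallel.
    · apply hcr
      have : (1 - w') * cross (c - x) (c - x) = s' * cross (c - x) (c' - x) := by
        have e2 : (1 - w') • (c - x) = s' • (c' - x) := by linear_combination (norm := module) (1 : ℝ) • e'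
        have h0 := congrArg (fun v : Plane => v 0) e2
        have h1 := congrArg (fun v : Plane => v 1) e2
        simp only [PiLp.smul_apply, smul_eq_mul] at h0 h1
        simp only [cross]
        linear_combination (c - x) 0 * h1 - (c - x) 1 * h0
      have h0 : cross (c - x) (c - x) = 0 := by simp [cross, mul_comm]
      rw [h0, mul_zero] at this
      exact (mul_eq_zero.1 this.symm).resolve_left hs'.ne'

/-! ### Circumdisks and the count -/

lemma isCircumdisk_unique {K : Geometry.SimplicialComplex ℝ Plane} {t : Finset Plane}
    (ht : t ∈ triangles K) {D D' : Set Plane} (h : IsCircumdisk t D) (h' : IsCircumdisk t D') :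
    D = D' := by
  classical
  obtain ⟨o, r, hr, rfl⟩ := h
  obtain ⟨o', r', hr', rfl⟩ := h'
  obtain ⟨a, b, c, hab, hac, hbc, rfl⟩ := Finset.card_eq_three.1 ht.2
  have hne := cross_ne_zero_of_mem_triangles ht hab hac hbc (by simp) (by simp) (by simp)
  have hsq {v : Plane} (hv : v ∈ ({a, b, c} : Finset Plane)) :
      (v 0 - o 0) ^ 2 + (v 1 - o 1) ^ 2 = r ^ 2 ∧ (v 0 - o' 0) ^ 2 + (v 1 - o' 1) ^ 2 = r' ^ 2 := by
    rw [← dist_sq_eq_coords, ← dist_sq_eq_coords, hr v hv, hr' v hv]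
    exact ⟨rfl, rfl⟩
  obtain ⟨ha, ha'⟩ := hsq (v := a) (by simp)
  obtain ⟨hb, hb'⟩ := hsq (v := b) (by simp)
  obtain ⟨hc, hc'⟩ := hsq (v := c) (by simp)
  simp only [cross, PiLp.sub_apply] at hne
  -- Subtracting circle equations leaves two linear equations for the centre, with determinant
  -- `hne`.
  have hoo : o = o' := by
    apply plane_ext <;> refine mul_left_cancel₀ hne ?_
    · linear_combination (1 / 2) * ((b 1 - c 1) * (ha' - hc' - ha + hc) -
        (a 1 - c 1) * (hb' - hc' - hb + hc))
    · linear_combination (1 / 2) * ((a 0 - c 0) * (hb' - hc' - hb + hc) -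
        (b 0 - c 0) * (ha' - hc' - ha + hc))
  subst hoo
  rw [← hr a (by simp), ← hr' a (by simp)]

/-- A circumdisk of a triangle, its interior being an open disk. -/
lemma IsCircumdisk.exists_interior_eq {K : Geometry.SimplicialComplex ℝ Plane} {t : Finset Plane}
    (ht : t ∈ triangles K) {D : Set Plane} (h : IsCircumdisk t D) :
    ∃ o r, (∀ v ∈ t, dist v o = r) ∧ interior D = Metric.ball o r := by
  classical
  obtain ⟨o, r, hr, rfl⟩ := h
  refine ⟨o, r, hr, interior_closedBall o ?_⟩
  rintro rfl
  obtain ⟨a, b, c, hab, -, -, rfl⟩ := Finset.card_eq_three.1 ht.2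
  exact hab ((dist_eq_zero.1 (hr a (by simp))).trans (dist_eq_zero.1 (hr b (by simp))).symm)

lemma pos_of_mem_triangleAngles {K : Geometry.SimplicialComplex ℝ Plane} {θ : ℝ}
    (h : θ ∈ triangleAngles K) : 0 < θ := by
  classical
  obtain ⟨p, q, r, ht, rfl⟩ := h
  obtain ⟨hpq, hpr, hqr⟩ := ne_of_card_eq_three ht.2
  have hne := cross_ne_zero_of_mem_triangles ht hpr hpq hqr.symm (by simp) (by simp) (by simp)
  refine lt_of_le_of_ne (EuclideanGeometry.angle_nonneg _ _ _) fun h0 => hne ?_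
  have := norm_mul_norm_mul_sin_angle (p - q) (r - q)
  change 0 = InnerProductGeometry.angle (p - q) (r - q) at h0
  rw [← h0, Real.sin_zero, mul_zero] at this
  exact abs_eq_zero.1 this.symm

lemma le_pi_of_mem_triangleAngles {K : Geometry.SimplicialComplex ℝ Plane} {θ : ℝ}
    (h : θ ∈ triangleAngles K) : θ ≤ Real.pi := by
  obtain ⟨p, q, r, -, rfl⟩ := h
  exact EuclideanGeometry.angle_le_pi _ _ _

lemma IsTriangulation.mem_of_mem_triangles {S : Finset Plane}
    {K : Geometry.SimplicialComplex ℝ Plane} (hK : IsTriangulation S K) {t : Finset Plane}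
    (ht : t ∈ triangles K) {v : Plane} (hv : v ∈ t) : v ∈ S := by
  have : v ∈ K.vertices := K.down_closed ht.1 (Finset.singleton_subset_iff.2 hv) (by simp)
  rw [hK.vertices_eq] at this
  exact_mod_cast this

lemma IsTriangulation.finite_triangles {S : Finset Plane}
    {K : Geometry.SimplicialComplex ℝ Plane} (hK : IsTriangulation S K) : (triangles K).Finite :=
  S.powerset.finite_toSet.subset fun _ ht =>
    Finset.mem_coe.2 (Finset.mem_powerset.2 fun _ hv => hK.mem_of_mem_triangles ht hv)

lemma ncard_triangles_le {S : Finset Plane} {K : Geometry.SimplicialComplex ℝ Plane}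
    (hK : IsDelaunayTriangulation S K) {α : ℝ} (hα : IsSharpestAngle K α) (x : Plane) :
    ({t | t ∈ triangles K ∧ ∃ D, IsCircumdisk t D ∧ x ∈ interior D}.ncard : ℝ) ≤
      2 * Real.pi / α := by
  classical
  have hα0 := pos_of_mem_triangleAngles hα.1
  have hαπ := le_pi_of_mem_triangleAngles hα.1
  set T := {t | t ∈ triangles K ∧ ∃ D, IsCircumdisk t D ∧ x ∈ interior D} with hT
  have hfin : T.Finite := hK.finite_triangles.subset fun t ht => ht.1
  have hex : ∀ t ∈ T, ∃ (o : Plane) (r : ℝ) (a b c : Plane), (∀ v ∈ t, dist v o = r) ∧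
      dist x o < r ∧ (∀ s ∈ S, r ≤ dist s o) ∧ t = {a, b, c} ∧ IsApex x a b c := by
    rintro t ⟨ht, D, hD, hxD⟩
    obtain ⟨o, r, hr, hint⟩ := hD.exists_interior_eq ht
    rw [hint] at hxD
    obtain ⟨a, b, c, habc, hap⟩ := exists_isApex ht hr hxD
    refine ⟨o, r, a, b, c, hr, hxD, fun s hs => ?_, habc, hap⟩
    have := hK.empty_circumdisk t ht D hD s hs
    rw [hint] at this
    simpa using this
  choose! o r a b c hr hx hempty htri hap using hex
  have hmem : ∀ t ∈ T, ({a t, b t, c t} : Finset Plane) ∈ triangles K := fun t ht =>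
    htri t ht ▸ ht.1
  have hct : ∀ t ∈ T, c t ∈ t := fun t ht => by
    have : c t ∈ ({a t, b t, c t} : Finset Plane) := by simp
    rwa [← htri t ht] at this
  have hcS : ∀ t ∈ T, c t ∈ S := fun t ht => hK.mem_of_mem_triangles ht.1 (hct t ht)
  have hinj : ∀ t ∈ T, ∀ t' ∈ T, c t = c t' → t = t' := by
    intro t ht t' ht' hcc
    have hm := hmem t ht
    have hm' := hmem t' ht'
    have hp' := hap t' ht'
    rw [← hcc] at hm' hp'
    have hsub := subset_of_isApex hm hm' (hap t ht) hp'
    have := Finset.eq_of_subset_of_card_le hsub (by rw [hm.2, hm'.2])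
    rw [htri t ht, htri t' ht', this, hcc]
  rw [le_div_iff₀ hα0, Set.ncard_eq_toFinset_card T hfin]
  refine card_mul_le_two_pi_of_le_angle hfin.toFinset (fun t => c t - x) hα0 hαπ ?_ ?_
  · intro t ht h0
    rw [Set.Finite.mem_toFinset] at ht
    have := hx t ht
    rw [← sub_eq_zero.1 h0, hr t ht _ (hct t ht)] at this
    exact lt_irrefl _ this
  · intro t ht t' ht' hne
    rw [Set.Finite.mem_toFinset] at ht ht'
    have hrt := hr t ht
    have hrt' := hr t' ht'
    refine le_angle_of_isApex hα.2 hαπ (hmem t ht) (hmem t' ht') (htri t ht ▸ hrt)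
      (htri t' ht' ▸ hrt') (hx t ht) (hx t' ht') (hempty t ht _ (hcS t' ht'))
      (hempty t' ht' _ (hcS t ht)) (hap t ht) (hap t' ht') fun h => hne (hinj t ht t' ht' h)

end PlanarDelaunay

theorem mainTheorem5 (S : Finset PlanarDelaunay.Plane)
    (DT : Geometry.SimplicialComplex ℝ PlanarDelaunay.Plane)
    (hDT : PlanarDelaunay.IsDelaunayTriangulation S DT)
    (α : ℝ) (hα : PlanarDelaunay.IsSharpestAngle DT α) (x : PlanarDelaunay.Plane) :
    -- distinct Delaunay circumdisks with `x` in their interior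
    ({D | D ∈ PlanarDelaunay.circumdisks DT ∧ x ∈ interior D}.Finite ∧
      ({D | D ∈ PlanarDelaunay.circumdisks DT ∧ x ∈ interior D}.ncard : ℝ) ≤ 2 * Real.pi / α) ∧
    -- the same bound when the circumdisks are counted once per Delaunay triangle
    ({t | t ∈ PlanarDelaunay.triangles DT ∧
        ∃ D, PlanarDelaunay.IsCircumdisk t D ∧ x ∈ interior D}.Finite ∧
      ({t | t ∈ PlanarDelaunay.triangles DT ∧
        ∃ D, PlanarDelaunay.IsCircumdisk t D ∧ x ∈ interior D}.ncard : ℝ) ≤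
          2 * Real.pi / α) := by
  have hfin : {t | t ∈ PlanarDelaunay.triangles DT ∧
      ∃ D, PlanarDelaunay.IsCircumdisk t D ∧ x ∈ interior D}.Finite :=
    hDT.finite_triangles.subset fun t ht => ht.1
  have hle := PlanarDelaunay.ncard_triangles_le hDT hα x
  have hex : ∀ D ∈ {D | D ∈ PlanarDelaunay.circumdisks DT ∧ x ∈ interior D},
      ∃ t, t ∈ PlanarDelaunay.triangles DT ∧ PlanarDelaunay.IsCircumdisk t D := by
    rintro D ⟨⟨t, ht, hD⟩, -⟩
    exact ⟨t, ht, hD⟩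
  -- A triangle determines its circumdisk, so choosing a triangle for each disk is injective and the
  -- bound for triangles carries over.
  choose! f hf hfD using hex
  have hmaps : Set.MapsTo f {D | D ∈ PlanarDelaunay.circumdisks DT ∧ x ∈ interior D}
      {t | t ∈ PlanarDelaunay.triangles DT ∧
        ∃ D, PlanarDelaunay.IsCircumdisk t D ∧ x ∈ interior D} :=
    fun D hD => ⟨hf D hD, D, hfD D hD, hD.2⟩
  have hinj : Set.InjOn f {D | D ∈ PlanarDelaunay.circumdisks DT ∧ x ∈ interior D} :=
    fun D hD D' hD' h => PlanarDelaunay.isCircumdisk_unique (hf D hD) (hfD D hD)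
      (h ▸ hfD D' hD')
  have hcard := Set.ncard_le_ncard_of_injOn f hmaps hinj hfin
  exact ⟨⟨Set.Finite.of_injOn hmaps hinj hfin, (Nat.cast_le.2 hcard).trans hle⟩, hfin, hle⟩
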